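/- Write $\bar x=(x,1)\in\mathbb R^{n+1}$ for $x\in\mathbb R^n$, put $\operatorname{sign}(t)=1$ for $t\ge 0$ and $\operatorname{sign}(t)=-1$ for $t<0$, and let $\operatorname{argmax}$ denote the smallest maximizing index. Let $\mathcal W^{n}=\{x\mapsto \operatorname{sign}\langle w,\bar x\rangle : w\in\mathbb R^{n+1}\}$ be the class of halfspaces over $\mathbb R^n$, and let $\mathcal L=\{x\mapsto \operatorname{argmax}_{i\in[k]}(W\bar x)_i : W\in\mathbb R^{k\times(d+1)}\}$ be the multiclass SVM class over $\mathbb R^d$ with labels $[k]=\{1,\dots,k\}$. A tree $T$ for $k$ classes is a full binary tree whose leaves are labelled bijectively by $[k]$; $\mathcal W^{n}_T$ is the class of predictors $\mathbb R^n\to[k]$ obtained by placing a classifier from $\mathcal W^{n}$ at every internal node of $T$ and mapping $x$ to the label of the leaf reached from the root by going right where the classifier has value $1$ at $x$ and left where it has value $-1$. The one-versus-all class $\mathcal W^{n}_{\mathrm{OvA}}$ consists of the predictors $x\mapsto\operatorname{argmax}_{i\in[k]}\sum_{j=1}^k M_{ij}h_j(x)$ with $h_1,\dots,h_k\in\mathcal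 W^{n}$, where $M_{ij}=1$ if $i=j$ and $M_{ij}=-1$ otherwise. For a map $\iota$, write $\mathcal H\circ\iota=\{h\circ\iota : h\in\mathcal H\}$. A class $\mathcal H$ of predictors $\mathbb R^d\to[k]$ essentially contains a class $\mathcal H'$ of such predictors if for every probability distribution $\mathcal D$ on $\mathbb R^d\times[k]$ $$\inf_{h\in\mathcal H}\Pr_{(x,y)\sim\mathcal D}[h(x)\ne y]\ \le\ \inf_{h\in\mathcal H'}\Pr_{(x,y)\sim\mathcal D}[h(x)\ne y].$$ Theorem. There are universal constants $c>0$ and $p\in\mathbb N$ such that for all integers $d,k\ge 2$ and $d'\ge 0$ and every map $\iota:\mathbb R^d\to\mathbb R^{d'}$: if $\mathcal W^{d'}_T\circ\iota$ essentially contains $\mathcal L$ for some tree $T$ for $k$ classes, or if $\mathcal W^{d'}_{\mathrm{OvA}}\circ\iota$ essentially contains $\mathcal L$, then $$d'\ \ge\ c\,\frac{dk}{\log^{p}(dk)},$$ that is, $d'=\tilde\Omega(dk)$. -/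

import Mathlib

open MeasureTheory

namespace Multiclass

/-! ### Conventions: sign, argmax, bias coordinate -/

/-- The sign of a real number, with values in `{±1}` and the convention `sign 0 = 1`. -/
noncomputable def sgn (t : ℝ) : ℤˣ := if 0 ≤ t then 1 else -1

/-- `i` is `argmax v`: the minimal index at which `v` attains its maximum. -/
def IsArgmax {k : ℕ} (v : Fin k → ℝ) (i : Fin k) : Prop :=
  (∀ j, v j ≤ v i) ∧ ∀ j, v j = v i → i ≤ j

/-- The argmax exists and is unique, so that `IsArgmax` defines a function. -/
theorem existsUnique_isArgmax {k : ℕ} (hk : 1 ≤ k) (v : Fin k → ℝ) :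
    ∃! i, IsArgmax v i := by
  classical
  have : Nonempty (Fin k) := ⟨⟨0, hk⟩⟩
  obtain ⟨m, hm⟩ := Finite.exists_max v
  let s : Finset (Fin k) := Finset.univ.filter fun i => v i = v m
  have hs : s.Nonempty := ⟨m, by simp [s]⟩
  have h1 : v (s.min' hs) = v m := (Finset.mem_filter.1 (s.min'_mem hs)).2
  refine ⟨s.min' hs, ⟨fun j => h1 ▸ hm j, fun j hj => ?_⟩, fun i hi => ?_⟩
  · exact s.min'_le j (by simp [s, hj, h1])
  · refine le_antisymm (hi.2 _ (le_antisymm (hi.1 _) (h1 ▸ hm i))) (s.min'_le i ?_)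
    simpa [s] using le_antisymm (hm i) (hi.1 m)

/-- The vector `(x, 1)`, obtained from `x` by appending the bias coordinate. -/
def withBias {d : ℕ} (x : Fin d → ℝ) : Fin (d + 1) → ℝ := Fin.snoc (α := fun _ => ℝ) x 1

/-! ### Approximation error and essential containment -/

/-- The error `Pr_{(x,y) ∼ D} [h x ≠ y]` of a predictor `h`. -/
noncomputable def err {X Y : Type*} [MeasurableSpace X] [MeasurableSpace Y]
    (D : Measure (X × Y)) (h : X → Y) : ENNReal :=
  D {z | h z.1 ≠ z.2}

/-- The approximation error of a hypothesis class: the infimum of the errors of its members. -/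
noncomputable def approxErr {X Y : Type*} [MeasurableSpace X] [MeasurableSpace Y]
    (D : Measure (X × Y)) (H : Set (X → Y)) : ENNReal :=
  ⨅ h ∈ H, err D h

/-- `H` essentially contains `H'`: for every distribution, the approximation error of `H` is
at most that of `H'`. -/
def EssentiallyContains {X Y : Type*} [MeasurableSpace X] [MeasurableSpace Y]
    (H H' : Set (X → Y)) : Prop :=
  ∀ D : Measure (X × Y), IsProbabilityMeasure D → approxErr D H ≤ approxErr D H'

/-- The class `H ∘ ι = {h ∘ ι : h ∈ H}`. -/
def precomp {X X' Y : Type*} (H : Set (X' → Y)) (ι : X → X') : Set (X → Y) :=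
  {g | ∃ h ∈ H, g = h ∘ ι}

/-! ### Halfspaces and multiclass SVM -/

/-- Linear separators (halfspaces with bias) over `ℝ^d`. -/
def halfspaces (d : ℕ) : Set ((Fin d → ℝ) → ℤˣ) :=
  {h | ∃ w : Fin (d + 1) → ℝ, ∀ x, h x = sgn (w ⬝ᵥ withBias x)}

/-- The class of multiclass SVM over `ℝ^d` with `k` labels: the predictors
`x ↦ argmax_i (W (x, 1))_i` with `W` a real `k × (d + 1)` matrix. -/
def msvm (d k : ℕ) : Set ((Fin d → ℝ) → Fin k) :=
  {h | ∃ W : Matrix (Fin k) (Fin (d + 1)) ℝ, ∀ x, IsArgmax (W.mulVec (withBias x)) (h x)}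

/-! ### Tree-based classifiers -/

/-- Full binary trees with leaves labelled by elements of `α`. -/
inductive ClassTree (α : Type) : Type
  | leaf (a : α) : ClassTree α
  | node (l r : ClassTree α) : ClassTree α

namespace ClassTree

/-- The list of the labels of the leaves, from left to right. -/
def leaves {α : Type} : ClassTree α → List α
  | leaf a => [a]
  | node l r => l.leaves ++ r.leaves

/-- The labelling of the leaves is a bijection onto `α`. -/
def IsLabelBijective {α : Type} (T : ClassTree α) : Prop :=
  T.leaves.Nodup ∧ ∀ a, a ∈ T.leaves

/-- The internal nodes of a tree. -/
inductive Node {α : Type} : ClassTree α → Type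
  | root (l r : ClassTree α) : Node (ClassTree.node l r)
  | left {l : ClassTree α} (r : ClassTree α) (v : Node l) : Node (ClassTree.node l r)
  | right (l : ClassTree α) {r : ClassTree α} (v : Node r) : Node (ClassTree.node l r)

/-- The label reached from the root when binary classifiers `C` are assigned to the internal
nodes: at a node `v` go to the right child if `C v x = 1` and to the left one if `C v x = -1`. -/
def predict {α X : Type} : (T : ClassTree α) → (T.Node → X → ℤˣ) → X → α
  | leaf a, _, _ => a
  | node l r, C, x =>
      if C (Node.root l r) x = 1 then r.predict (fun v => C (Node.right l v)) x
      else l.predict (fun v => C (Node.left r v)) x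

end ClassTree

/-- The class of the tree `T` over a binary class `H`. -/
def treeClass {α X : Type} (H : Set (X → ℤˣ)) (T : ClassTree α) : Set (X → α) :=
  {h | ∃ C : T.Node → X → ℤˣ, (∀ v, C v ∈ H) ∧ h = T.predict C}

/-! ### Output codes and one-versus-all -/

/-- The class of the code `M` over a binary class `H`: the predictors
`x ↦ argmax_i ∑_j M i j * u_j x` with `u_1, …, u_l ∈ H`. -/
def codeClass {X : Type} {k l : ℕ} (H : Set (X → ℤˣ)) (M : Matrix (Fin k) (Fin l) ℝ) :
    Set (X → Fin k) :=
  {h | ∃ u : Fin l → X → ℤˣ, (∀ j, u j ∈ H) ∧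
    ∀ x, IsArgmax (fun i => ∑ j, M i j * (((u j x : ℤˣ) : ℤ) : ℝ)) (h x)}

/-- The one-versus-all code: `1` on the diagonal and `-1` off it. -/
def ovaMatrix (k : ℕ) : Matrix (Fin k) (Fin k) ℝ :=
  Matrix.of fun i j => if i = j then 1 else -1

/-- The one-versus-all class over a binary class `H`. -/
def ovaClass {X : Type} (k : ℕ) (H : Set (X → ℤˣ)) : Set (X → Fin k) :=
  codeClass H (ovaMatrix k)

end Multiclass

/-!
The bound holds without any logarithmic factor: `d' ≥ d k / 120`.

*Multiclass SVM is rich on the moment curve.* Put finitely many points on the curve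
`t ↦ (t, t², …, t^d)`, at distinct integer parameters. Affine functionals restrict to polynomials
of degree at most `d`, and the square of `∏ (X - t_i)`, over at most `d / 2` parameters, is such a
polynomial; it vanishes at the chosen points and is at least `1` at all others. Hence every
labelling in which all classes but one have at most `d / 2` points is realized
(`exists_mem_msvm_eq`). In particular, for a set `J` of labels and a label `a ∉ J`, one can find
`#J * (d / 2)` points each of whose subsets is the preimage of `J` under some predictor of the
class that sends all other points to `a` (`exists_mem_msvm_mem_or_eq`).

*Trees and one-versus-all are poor.* Essential containment transfers realizable labellings of
finite families (`EssentiallyContains.exists_eq`). At the root of a tree a single halfspace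
separates the labels on the right from those on the left, and in one-versus-all the label with
index `1` is predicted exactly where the halfspace of index `0` is negative and that of index `1`
is positive. In both cases some `J` with `#J ≥ k / 2` and `Jᶜ` nonempty is cut out, or its
complement is, by the difference of two halfspaces in `ℝ^{d'}`. The halfspaces have VC dimension
at most `d' + 1`, so by the Sauer–Shelah lemma differences of two of them shatter fewer than
`10 (d' + 1)` points (`card_lt_of_forall_exists_halfspaces`). Comparing both counts gives the
bound up to the case `d' = 0`, in which the embedded predictors are constant.
-/

namespace Multiclass

open Finset Polynomial

/-! ### Essential containment on finite families -/

/-- Apply the containment to the uniform distribution on the labelled family: an error below the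
mass of one sample point means no error at all. -/
theorem EssentiallyContains.exists_eq {X Y T : Type*} [MeasurableSpace X] [MeasurableSpace Y]
    [MeasurableSingletonClass X] [MeasurableSingletonClass Y] [Fintype T]
    {H H' : Set (X → Y)} (hH : EssentiallyContains H H') {g : X → Y} (hg : g ∈ H')
    (x : T → X) [Nonempty T] : ∃ h ∈ H, ∀ t, h (x t) = g (x t) := by
  classical
  let _ : MeasurableSpace T := ⊤
  let F : T → X × Y := fun t => (x t, g (x t))
  have hF : Measurable F := measurable_from_top
  let μ : Measure T := (PMF.uniformOfFintype T).toMeasure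
  have hD : IsProbabilityMeasure (μ.map F) :=
    Measure.isProbabilityMeasure_map hF.aemeasurable
  have h0 : err (μ.map F) g = 0 := by
    have hm : MeasurableSet (Set.range F) := (Set.finite_range F).measurableSet
    refine measure_mono_null (t := (Set.range F)ᶜ) ?_ ?_
    · rintro z hz ⟨t, rfl⟩
      exact hz rfl
    · rw [Measure.map_apply hF hm.compl]
      convert measure_empty (μ := μ)
      ext t
      simp
  have h1 : approxErr (μ.map F) H ≤ 0 :=
    (hH _ hD).trans ((iInf₂_le g hg).trans h0.le)
  have hpos : (0 : ENNReal) < (Fintype.card T : ENNReal)⁻¹ :=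
    ENNReal.inv_pos.2 (ENNReal.natCast_ne_top _)
  have h2 := h1.trans_lt hpos
  simp only [approxErr, iInf_lt_iff] at h2
  obtain ⟨h, hh, hlt⟩ := h2
  refine ⟨h, hh, fun t => ?_⟩
  by_contra hne
  refine absurd hlt (not_lt.2 ?_)
  calc (Fintype.card T : ENNReal)⁻¹ = μ {t} := by
        simp [μ, PMF.toMeasure_apply_singleton _ _ (MeasurableSet.singleton t)]
    _ ≤ μ (F ⁻¹' {z | h z.1 ≠ z.2}) :=
        measure_mono (Set.singleton_subset_iff.2 hne)
    _ ≤ err (μ.map F) h := Measure.le_map_apply hF.aemeasurable _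

/-! ### Multiclass SVM on the moment curve -/

/-- The point `(t, t², …, t^d)` of the moment curve. -/
def momentCurve (d : ℕ) (t : ℝ) : Fin d → ℝ := fun i => t ^ ((i : ℕ) + 1)

theorem exists_dotProduct_momentCurve {d : ℕ} (p : ℝ[X]) (hp : p.natDegree ≤ d) :
    ∃ w : Fin (d + 1) → ℝ, ∀ t, w ⬝ᵥ withBias (momentCurve d t) = p.eval t := by
  refine ⟨Fin.snoc (α := fun _ => ℝ) (fun i : Fin d => p.coeff (i + 1)) (p.coeff 0), fun t => ?_⟩
  rw [eval_eq_sum_range' (Nat.lt_succ_of_le hp), Finset.sum_range_succ', dotProduct,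
    Fin.sum_univ_castSucc, Finset.sum_range]
  simp [withBias, momentCurve]

/-- Any labelling of points of the moment curve in which every class, except possibly that of
`a`, has at most `d / 2` points is realized by multiclass SVM. -/
theorem exists_mem_msvm_eq {d k : ℕ} {T : Type*} [Fintype T] (τ : T → ℤ)
    (hτ : Function.Injective τ) (f : T → Fin k) (a : Fin k)
    (hf : ∀ j, j ≠ a → #{t | f t = j} ≤ d / 2) :
    ∃ h ∈ msvm d k, ∀ t, h (momentCurve d (τ t)) = f t := by
  classical
  -- The score of `a` is `0`; that of `j ≠ a` is `1 / 2` on its class and negative off it.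
  let q : Fin k → ℝ[X] := fun j => ∏ t with f t = j, (X - C (τ t : ℝ)) ^ 2
  let p : Fin k → ℝ[X] := fun j => if j = a then 0 else C (1 / 2) - q j
  have hdeg : ∀ j, (p j).natDegree ≤ d := by
    intro j
    by_cases hj : j = a
    · simp [p, hj]
    have hq : (q j).natDegree ≤ d := by
      refine (natDegree_prod_le _ _).trans ?_
      have : ∀ t ∈ ({t | f t = j} : Finset T), ((X - C (τ t : ℝ)) ^ 2).natDegree ≤ 2 :=
        fun t _ => by rw [natDegree_pow, natDegree_X_sub_C]
      have h2 := Finset.sum_le_card_nsmul _ _ _ this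
      have h3 := hf j hj
      simp only [smul_eq_mul] at h2 ⊢
      omega
    simp only [p, if_neg hj]
    refine (natDegree_sub_le _ _).trans ?_
    simp [hq]
  choose W hW using fun j => exists_dotProduct_momentCurve (p j) (hdeg j)
  have hqself : ∀ t, (q (f t)).eval (τ t : ℝ) = 0 := fun t => by
    simp only [q, eval_prod]
    exact Finset.prod_eq_zero (i := t) (by simp) (by simp)
  have hqoff : ∀ t j, f t ≠ j → 1 ≤ (q j).eval (τ t : ℝ) := fun t j htj => by
    have h1 : (q j).eval (τ t : ℝ) =
        ((∏ s with f s = j, (τ t - τ s) ^ 2 : ℤ) : ℝ) := by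
      simp [q, eval_prod]
    rw [h1]
    have h2 : 0 < ∏ s with f s = j, (τ t - τ s) ^ 2 := by
      refine Finset.prod_pos fun s hs => ?_
      have hne : τ t - τ s ≠ 0 := fun h0 => htj (by
        rw [hτ (sub_eq_zero.1 h0)]
        simpa using hs)
      positivity
    exact_mod_cast h2
  have hlt : ∀ t j, j ≠ f t → (p j).eval (τ t : ℝ) < (p (f t)).eval (τ t : ℝ) := by
    intro t j hj
    have h1 := hqself t
    have h2 := hqoff t j (Ne.symm hj)
    by_cases hja : j = a
    · have hta : f t ≠ a := fun h => hj (hja.trans h.symm)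
      simp [p, hja, hta, h1]
    · by_cases hta : f t = a
      · simp only [p, hja, hta, if_true, if_false, eval_sub, eval_C, eval_zero]
        linarith
      · simp only [p, hja, hta, if_false, eval_sub, eval_C, h1]
        linarith
  have hk : 1 ≤ k := a.pos
  choose h hh _ using fun x : Fin d → ℝ =>
    existsUnique_isArgmax hk ((Matrix.of W).mulVec (withBias x))
  refine ⟨h, ⟨Matrix.of W, hh⟩, fun t => ?_⟩
  by_contra hne
  have h1 := (hh (momentCurve d (τ t))).1 (f t)
  have h2 : ∀ j, (Matrix.of W).mulVec (withBias (momentCurve d (τ t))) j = (p j).eval (τ t : ℝ) :=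
    fun j => hW j _
  rw [h2, h2] at h1
  exact absurd (hlt t _ hne) (not_lt.2 h1)

/-- The index type of the points is `J × Fin (d / 2)`: the points `(j, r)` of the given set `U`
are labelled `j`, the others `a`. -/
theorem exists_mem_msvm_mem_or_eq {d k : ℕ} (J : Finset (Fin k)) (a : Fin k) :
    ∃ x : J × Fin (d / 2) → Fin d → ℝ, ∀ U : Finset (J × Fin (d / 2)),
      ∃ h ∈ msvm d k, ∀ t, h (x t) ∈ J ∧ t ∈ U ∨ h (x t) = a ∧ t ∉ U := by
  classical
  let τ : J × Fin (d / 2) → ℤ := fun t => (Fintype.equivFin _ t : ℕ)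
  have hτ : Function.Injective τ := fun s t h => by
    have h' : (Fintype.equivFin _ s : ℕ) = Fintype.equivFin _ t := Int.natCast_inj.1 h
    exact (Fintype.equivFin _).injective (Fin.ext h')
  refine ⟨fun t => momentCurve d (τ t), fun U => ?_⟩
  obtain ⟨h, hh, hf⟩ := exists_mem_msvm_eq (d := d) τ hτ
    (fun t => if t ∈ U then (t.1 : Fin k) else a) a (fun j hj => by
      calc _ ≤ #(univ : Finset (Fin (d / 2))) := by
            refine Finset.card_le_card_of_injOn Prod.snd (fun _ _ => by simp) ?_
            have key : ∀ t ∈ ({t | (if t ∈ U then (t.1 : Fin k) else a) = j} :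
                Finset (J × Fin (d / 2))), (t.1 : Fin k) = j := fun t ht => by
              simp only [mem_filter, mem_univ, true_and] at ht
              split_ifs at ht with h
              · exact ht
              · exact absurd ht.symm hj
            intro s hs t ht hst
            exact Prod.ext (Subtype.ext ((key s hs).trans (key t ht).symm)) hst
        _ = d / 2 := by simp)
  refine ⟨h, hh, fun t => ?_⟩
  rw [hf t]
  by_cases ht : t ∈ U
  · left
    simp [ht]
  · right
    simp [ht]

/-! ### Differences of two halfspaces -/

theorem sgn_eq_one_iff {t : ℝ} : sgn t = 1 ↔ 0 ≤ t := by
  unfold sgn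
  split_ifs with h
  · simp [h]
  · simp [h]

theorem eq_neg_one_iff_ne_one (u : ℤˣ) : u = -1 ↔ u ≠ 1 := by
  rcases Int.units_eq_one_or u with rfl | rfl <;> decide

open Classical in
/-- The subsets of a finite family of points of `ℝ^d` that are cut out by halfspaces. -/
noncomputable def halfspaceTraces {d : ℕ} {T : Type*} [Fintype T] (y : T → Fin d → ℝ) :
    Finset (Finset T) :=
  {s | ∃ h ∈ halfspaces d, ∀ t, t ∈ s ↔ h (y t) = 1}

/-- Halfspaces in `ℝ^d` have VC dimension at most `d + 1`. -/
theorem card_le_of_shatters_halfspaceTraces {d : ℕ} {T : Type*} [Fintype T] [DecidableEq T]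
    (y : T → Fin d → ℝ) {s : Finset T} (hs : (halfspaceTraces y).Shatters s) :
    #s ≤ d + 1 := by
  classical
  by_contra! hcard
  have hdep : ¬ LinearIndependent ℝ (fun t : s => withBias (y t)) := fun hli => by
    have := hli.fintype_card_le_finrank
    simp at this
    omega
  obtain ⟨g, hg, i, hi⟩ := Fintype.not_linearIndependent_iff.1 hdep
  -- Negating the relation if necessary, some coefficient is negative.
  obtain ⟨g, hg, i, hi⟩ : ∃ g : s → ℝ, ∑ t, g t • withBias (y t) = 0 ∧ ∃ i, g i < 0 := by
    rcases lt_or_gt_of_ne hi with h | h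
    · exact ⟨g, hg, i, h⟩
    · refine ⟨-g, ?_, i, by simpa using h⟩
      simp only [Pi.neg_apply, neg_smul, Finset.sum_neg_distrib, hg, neg_zero]
  obtain ⟨u, hu, hus⟩ := hs (t := ({t : s | 0 ≤ g t} : Finset s).map (Function.Embedding.subtype _))
    (fun t ht => by
      simp only [mem_map] at ht
      obtain ⟨r, -, rfl⟩ := ht
      exact r.2)
  simp only [halfspaceTraces, mem_filter, mem_univ, true_and] at hu
  obtain ⟨h, ⟨w, hw⟩, hu⟩ := hu
  have hsign : ∀ t : s, 0 ≤ w ⬝ᵥ withBias (y t) ↔ 0 ≤ g t := fun t => by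
    have h1 : (t : T) ∈ s ∩ u ↔ 0 ≤ g t := by
      rw [hus]
      simp
    rw [← h1, mem_inter, hu, hw, sgn_eq_one_iff]
    simp
  have hsum : ∑ t, g t * (w ⬝ᵥ withBias (y t)) = 0 := by
    have := congrArg (fun v => w ⬝ᵥ v) hg
    simpa [dotProduct_sum, dotProduct_smul] using this
  have hnn : ∀ t : s, 0 ≤ g t * (w ⬝ᵥ withBias (y t)) := fun t => by
    by_cases ht : 0 ≤ g t
    · exact mul_nonneg ht ((hsign t).2 ht)
    · have := (hsign t).not.2 ht
      exact mul_nonneg_of_nonpos_of_nonpos (not_le.1 ht).le (not_le.1 this).le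
  have hz := (Finset.sum_eq_zero_iff_of_nonneg fun t _ => hnn t).1 hsum i (mem_univ _)
  have hwi := not_le.1 ((hsign i).not.2 (not_le.2 hi))
  exact absurd hz (mul_pos_of_neg_of_neg hi hwi).ne'

/-- A Chernoff-type bound: weight the terms of the binomial expansion of `(8 + 1)^n`. -/
theorem sum_choose_mul_pow_le (n D : ℕ) :
    (∑ i ∈ Iic D, n.choose i) * 8 ^ n ≤ 8 ^ D * 9 ^ n := by
  have h9 : 9 ^ n = ∑ i ∈ range (n + 1), 8 ^ (n - i) * n.choose i := by
    have := add_pow 1 8 n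
    norm_num at this
    exact this
  rw [h9, Finset.sum_mul, Finset.mul_sum]
  have hterm : ∀ i ∈ Iic D, n.choose i * 8 ^ n ≤ 8 ^ D * (8 ^ (n - i) * n.choose i) := by
    intro i hi
    rw [← mul_assoc, ← pow_add, mul_comm]
    refine Nat.mul_le_mul_right _ (Nat.pow_le_pow_right (by norm_num) ?_)
    have := Finset.mem_Iic.1 hi
    omega
  refine (Finset.sum_le_sum hterm).trans ?_
  refine Finset.sum_le_sum_of_ne_zero fun i _ hi => ?_
  rw [mem_range]
  by_contra! hlt
  exact hi (by simp [Nat.choose_eq_zero_of_lt (show n < i by omega)])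

/-- If every subset of a finite family in `ℝ^d` is the part on which one halfspace classifier is
negative and another one is positive, then the family has fewer than `10 (d + 1)` members. -/
theorem card_lt_of_forall_exists_halfspaces {d : ℕ} {T : Type*} [Fintype T] (y : T → Fin d → ℝ)
    (hy : ∀ U : Finset T, ∃ g ∈ halfspaces d, ∃ h ∈ halfspaces d,
      ∀ t, t ∈ U ↔ g (y t) = -1 ∧ h (y t) = 1) :
    Fintype.card T < 10 * (d + 1) := by
  classical
  set n := Fintype.card T
  set A := halfspaceTraces y with hA
  have hsurj : (univ : Finset (Finset T)) ⊆ (A ×ˢ A).image fun q => q.2 \ q.1 := by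
    intro U _
    obtain ⟨g, hg, h, hh, hU⟩ := hy U
    refine mem_image.2 ⟨(({t | g (y t) = 1} : Finset T), ({t | h (y t) = 1} : Finset T)), ?_, ?_⟩
    · simp only [hA, halfspaceTraces, mem_product, mem_filter, mem_univ, true_and]
      exact ⟨⟨g, hg, fun _ => Iff.rfl⟩, ⟨h, hh, fun _ => Iff.rfl⟩⟩
    · ext t
      simp only [mem_sdiff, mem_filter, mem_univ, true_and, hU, eq_neg_one_iff_ne_one]
      exact and_comm
  have hpow : 2 ^ n ≤ #A * #A := by
    have := (card_le_card hsurj).trans card_image_le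
    rwa [card_univ, Fintype.card_finset, card_product] at this
  have hvc : A.vcDim ≤ d + 1 := by
    refine Finset.sup_le fun s hs => ?_
    exact card_le_of_shatters_halfspaceTraces y (mem_shatterer.1 hs)
  have hAle : #A ≤ ∑ i ∈ Iic (d + 1), n.choose i :=
    (card_le_card_shatterer A).trans (card_shatterer_le_sum_vcDim.trans
      (Finset.sum_le_sum_of_subset (Finset.Iic_subset_Iic.2 hvc)))
  have hA8 : #A * 8 ^ n ≤ 8 ^ (d + 1) * 9 ^ n :=
    (Nat.mul_le_mul_right _ hAle).trans (sum_choose_mul_pow_le n (d + 1))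
  have hmain : 128 ^ n ≤ 64 ^ (d + 1) * 81 ^ n := by
    calc 128 ^ n = 2 ^ n * (8 ^ n * 8 ^ n) := by
          rw [← mul_pow, ← mul_pow]
          norm_num
      _ ≤ #A * #A * (8 ^ n * 8 ^ n) := Nat.mul_le_mul_right _ hpow
      _ = #A * 8 ^ n * (#A * 8 ^ n) := by ring
      _ ≤ 8 ^ (d + 1) * 9 ^ n * (8 ^ (d + 1) * 9 ^ n) := Nat.mul_le_mul hA8 hA8
      _ = 64 ^ (d + 1) * 81 ^ n := by
          rw [mul_mul_mul_comm, ← mul_pow, ← mul_pow]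
          norm_num
  by_contra! hlarge
  obtain ⟨m, hm⟩ := Nat.exists_eq_add_of_le hlarge
  have hstrict : 64 ^ (d + 1) * 81 ^ n < 128 ^ n := by
    rw [hm, pow_add 81, pow_add 128, pow_mul, pow_mul, ← mul_assoc, ← mul_pow]
    refine Nat.mul_lt_mul_of_lt_of_le ?_ (Nat.pow_le_pow_left (by norm_num) m) (by positivity)
    exact Nat.pow_lt_pow_left (by norm_num) (by omega)
  exact absurd hmain (not_le.2 hstrict)

/-! ### The label sets that are cut out by halfspaces -/

theorem const_neg_one_mem_halfspaces (d : ℕ) : (fun _ => -1) ∈ halfspaces d := by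
  refine ⟨Fin.snoc (α := fun _ => ℝ) 0 (-1), fun x => ?_⟩
  have : (Fin.snoc (α := fun _ => ℝ) (0 : Fin d → ℝ) (-1)) ⬝ᵥ withBias x = -1 := by
    rw [dotProduct, Fin.sum_univ_castSucc]
    simp [withBias]
  rw [this]
  simp [sgn]

theorem ClassTree.predict_mem_leaves {α X : Type} (T : ClassTree α) (C : T.Node → X → ℤˣ)
    (x : X) : T.predict C x ∈ T.leaves := by
  induction T with
  | leaf a => simp [predict, leaves]
  | node l r hl hr =>
    simp only [predict, leaves, List.mem_append]
    split_ifs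
    · exact Or.inr (hr _)
    · exact Or.inl (hl _)

/-- A predictor of a tree sends a point to a label on the right of the root exactly where the
classifier at the root is positive. -/
theorem ClassTree.predict_node_mem_right_iff {α X : Type} {l r : ClassTree α}
    (hT : (ClassTree.node l r).leaves.Nodup) (C : (ClassTree.node l r).Node → X → ℤˣ) (x : X) :
    (ClassTree.node l r).predict C x ∈ r.leaves ↔ C (Node.root l r) x = 1 := by
  have hdisj := (List.nodup_append'.1 hT).2.2
  simp only [predict]
  split_ifs with h
  · simp [h, predict_mem_leaves]
  · simp only [h, iff_false]
    exact fun hr => hdisj (predict_mem_leaves l _ x) hr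

theorem ClassTree.leaves_ne_nil {α : Type} (T : ClassTree α) : T.leaves ≠ [] := by
  induction T with
  | leaf a => simp [leaves]
  | node l r hl hr => simp [leaves, hl]

/-- One-versus-all scores are `2 u_i - ∑ j, u_j`, so the least index with a positive classifier is
predicted; index `1` is predicted iff it is that least index. If no classifier is positive, all
scores are equal and the tie goes to index `0`. -/
theorem ovaClass_eq_one_iff {X : Type} {k : ℕ} {u : Fin k → X → ℤˣ} {x : X} {i i₀ i₁ : Fin k}
    (h₀ : (i₀ : ℕ) = 0) (h₁ : (i₁ : ℕ) = 1)
    (hi : IsArgmax (fun i => ∑ j, ovaMatrix k i j * (((u j x : ℤˣ) : ℤ) : ℝ)) i) :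
    i = i₁ ↔ u i₀ x = -1 ∧ u i₁ x = 1 := by
  have hscore : ∀ i, ∑ j, ovaMatrix k i j * (((u j x : ℤˣ) : ℤ) : ℝ) =
      2 * (((u i x : ℤˣ) : ℤ) : ℝ) - ∑ j, (((u j x : ℤˣ) : ℤ) : ℝ) := by
    intro i
    have h : ∀ j, ovaMatrix k i j * (((u j x : ℤˣ) : ℤ) : ℝ) =
        (if i = j then 2 * (((u j x : ℤˣ) : ℤ) : ℝ) else 0) - (((u j x : ℤˣ) : ℤ) : ℝ) := by
      intro j
      simp only [ovaMatrix, Matrix.of_apply]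
      split_ifs <;> ring
    simp only [h, Finset.sum_sub_distrib, Finset.sum_ite_eq, Finset.mem_univ, if_true]
  simp only [IsArgmax, hscore] at hi
  have hval : ∀ j, ((u j x = 1) ∧ (((u j x : ℤˣ) : ℤ) : ℝ) = 1) ∨
      ((u j x = -1) ∧ (((u j x : ℤˣ) : ℤ) : ℝ) = -1) := fun j => by
    rcases Int.units_eq_one_or (u j x) with h | h <;> simp [h]
  have hne : i₀ ≠ i₁ := fun h => by
    rw [h, h₁] at h₀
    exact one_ne_zero h₀
  constructor
  · rintro rfl
    have a1 := hi.1 i₀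
    have a2 : u i₀ x ≠ u i x := fun h => by
      have := Fin.le_def.1 (hi.2 i₀ (by rw [h]))
      omega
    rcases hval i₀ with ⟨b, b'⟩ | ⟨b, b'⟩ <;> rcases hval i with ⟨c, c'⟩ | ⟨c, c'⟩
    · exact absurd (b.trans c.symm) a2
    · rw [b', c'] at a1
      linarith
    · exact ⟨b, c⟩
    · exact absurd (b.trans c.symm) a2
  · rintro ⟨hu₀, hu₁⟩
    have a1 := hi.1 i₁
    rcases hval i with ⟨c, -⟩ | ⟨-, c'⟩
    · have hle := Fin.le_def.1 (hi.2 i₁ (by rw [hu₁, c]))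
      have hi₀ : (i : ℕ) ≠ 0 := fun h => by
        have : i = i₀ := Fin.ext (h.trans h₀.symm)
        rw [this, hu₀] at c
        exact absurd c (by decide)
      exact Fin.ext (by omega)
    · simp only [hu₁, c', Units.val_one, Int.cast_one] at a1
      linarith

/-! ### The lower bound on the dimension -/

/-- Suppose that, along a predictor of `H`, membership of the label in `B` is positivity on the
difference of two halfspaces, for a nontrivial set `B` of labels. Then one of `B` and `Bᶜ` has at
least `k / 2` labels, and either gives a lower bound for the dimension. -/
theorem le_of_essentiallyContains_of_mem_iff {d k d' : ℕ} (hd : 2 ≤ d)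
    (ι : (Fin d → ℝ) → Fin d' → ℝ) {H : Set ((Fin d' → ℝ) → Fin k)}
    (hH : EssentiallyContains (precomp H ι) (msvm d k))
    (B : Finset (Fin k)) {a b : Fin k} (ha : a ∉ B) (hb : b ∈ B)
    (hB : ∀ f ∈ H, ∃ g ∈ halfspaces d', ∃ h ∈ halfspaces d',
      ∀ y, f y ∈ B ↔ g y = -1 ∧ h y = 1) :
    d * k ≤ 120 * d' := by
  classical
  have hpos : 0 < d' := by
    by_contra! h0
    obtain rfl : d' = 0 := by omega
    -- A labelling of two points that is not constant.
    obtain ⟨g, hg, hga⟩ := exists_mem_msvm_eq (d := d) (T := Bool) (fun t => if t then 1 else 0)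
      (by decide) (fun t => if t then b else a) a (fun j hj => by
        refine le_trans (Finset.card_le_one.2 ?_) (show 1 ≤ d / 2 by omega)
        have : ∀ t : Bool, (if t then b else a) = j → t = true := fun t ht => by
          cases t
          · exact absurd ht.symm hj
          · rfl
        intro s hs t ht
        rw [this s (by simpa using hs), this t (by simpa using ht)])
    obtain ⟨f, ⟨f', -, rfl⟩, hf⟩ := hH.exists_eq hg
      fun t : Bool => momentCurve d ((if t then 1 else 0 : ℤ) : ℝ)
    have h1 := (hf true).trans (hga true)
    have h2 := (hf false).trans (hga false)
    rw [Function.comp_apply, Subsingleton.elim (ι _) 0] at h1 h2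
    have hab : b = a := h1.symm.trans h2
    exact ha (hab ▸ hb)
  have hbound : ∀ (J : Finset (Fin k)) (e : Fin k), e ∉ J → J.Nonempty →
      ((∀ j, j ∈ J ↔ j ∈ B) ∨ (∀ j, j ∈ J ↔ j ∉ B)) → #J * (d / 2) < 10 * (d' + 1) := by
    intro J e he hJ hJB
    obtain ⟨x, hx⟩ := exists_mem_msvm_mem_or_eq (d := d) J e
    have : Nonempty (J × Fin (d / 2)) :=
      ⟨(⟨hJ.choose, hJ.choose_spec⟩, ⟨0, by omega⟩)⟩
    have hJcut : ∀ U : Finset (J × Fin (d / 2)), ∃ f ∈ H, ∀ t, t ∈ U ↔ f (ι (x t)) ∈ J := by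
      intro U
      obtain ⟨g, hg, hgU⟩ := hx U
      obtain ⟨f, ⟨f', hf', rfl⟩, hf⟩ := hH.exists_eq hg x
      refine ⟨f', hf', fun t => ?_⟩
      have hft : f' (ι (x t)) = g (x t) := hf t
      rw [hft]
      rcases hgU t with ⟨h1, h2⟩ | ⟨h1, h2⟩
      · simp [h1, h2]
      · simp [h1, h2, he]
    have := card_lt_of_forall_exists_halfspaces (fun t => ι (x t)) fun U => by
      rcases hJB with hJB | hJB
      · obtain ⟨f, hf, hU⟩ := hJcut U
        obtain ⟨g, hg, h, hh, hgh⟩ := hB f hf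
        exact ⟨g, hg, h, hh, fun t => by rw [hU, hJB, hgh]⟩
      · obtain ⟨f, hf, hU⟩ := hJcut Uᶜ
        obtain ⟨g, hg, h, hh, hgh⟩ := hB f hf
        refine ⟨g, hg, h, hh, fun t => ?_⟩
        rw [← hgh, ← not_iff_not, ← mem_compl, hU, hJB]
    simpa using this
  have h1 := hbound B a ha ⟨b, hb⟩ (Or.inl fun _ => Iff.rfl)
  have h2 := hbound Bᶜ b (by simpa using hb) ⟨a, by simpa using ha⟩ (Or.inr fun j => by simp)
  have h3 : #B + #Bᶜ = k := by simp
  have h4 : k * (d / 2) < 20 * (d' + 1) := by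
    rw [← h3, add_mul]
    omega
  -- `d ≤ 3 (d / 2)` for `d ≥ 2`, and `d' + 1 ≤ 2 d'`.
  calc d * k ≤ 3 * (d / 2) * k := Nat.mul_le_mul_right _ (by omega)
    _ = 3 * (k * (d / 2)) := by ring
    _ ≤ 120 * d' := by omega

theorem le_of_essentiallyContains_tree {d k d' : ℕ} (hd : 2 ≤ d) (hk : 2 ≤ k)
    (ι : (Fin d → ℝ) → Fin d' → ℝ) (T : ClassTree (Fin k)) (hT : T.IsLabelBijective)
    (hH : EssentiallyContains (precomp (treeClass (halfspaces d') T) ι) (msvm d k)) :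
    d * k ≤ 120 * d' := by
  classical
  cases T with
  | leaf a =>
    have h0 := hT.2 ⟨0, by omega⟩
    have h1 := hT.2 ⟨1, by omega⟩
    simp only [ClassTree.leaves, List.mem_singleton] at h0 h1
    simpa using h0.trans h1.symm
  | node l r =>
    obtain ⟨a, ha⟩ := List.exists_mem_of_ne_nil _ l.leaves_ne_nil
    obtain ⟨b, hb⟩ := List.exists_mem_of_ne_nil _ r.leaves_ne_nil
    have hdisj := (List.nodup_append'.1 hT.1).2.2
    refine le_of_essentiallyContains_of_mem_iff hd ι hH r.leaves.toFinset (a := a) (b := b)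
      (by simpa using fun h => hdisj ha h) (by simpa using hb) ?_
    rintro f ⟨C, hC, rfl⟩
    refine ⟨_, const_neg_one_mem_halfspaces d', _, hC (.root l r), fun y => ?_⟩
    rw [List.mem_toFinset, ClassTree.predict_node_mem_right_iff hT.1]
    simp

theorem le_of_essentiallyContains_ova {d k d' : ℕ} (hd : 2 ≤ d) (hk : 2 ≤ k)
    (ι : (Fin d → ℝ) → Fin d' → ℝ)
    (hH : EssentiallyContains (precomp (ovaClass k (halfspaces d')) ι) (msvm d k)) :
    d * k ≤ 120 * d' := by
  let i₀ : Fin k := ⟨0, by omega⟩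
  let i₁ : Fin k := ⟨1, by omega⟩
  refine le_of_essentiallyContains_of_mem_iff hd ι hH {i₁} (a := i₀) (b := i₁)
    (by simp [i₀, i₁]) (by simp) ?_
  rintro f ⟨u, hu, hf⟩
  refine ⟨_, hu i₀, _, hu i₁, fun y => ?_⟩
  rw [mem_singleton]
  exact ovaClass_eq_one_iff rfl rfl (hf y)

end Multiclass

/-- The dimension of an embedding that lets halfspace trees or one-versus-all essentially
contain multiclass SVM is at least `c * (d * k) / log (d * k) ^ p`, where the constants `c > 0`
and `p` are universal. -/
theorem theorem7 :
    ∃ c : ℝ, 0 < c ∧ ∃ p : ℕ, ∀ d k d' : ℕ, 2 ≤ d → 2 ≤ k →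
      ∀ ι : (Fin d → ℝ) → (Fin d' → ℝ),
        ((∃ T : Multiclass.ClassTree (Fin k), T.IsLabelBijective ∧
            Multiclass.EssentiallyContains
              (Multiclass.precomp (Multiclass.treeClass (Multiclass.halfspaces d') T) ι)
              (Multiclass.msvm d k)) ∨
          Multiclass.EssentiallyContains
            (Multiclass.precomp (Multiclass.ovaClass k (Multiclass.halfspaces d')) ι)
            (Multiclass.msvm d k)) →
        c * ((d : ℝ) * (k : ℝ)) / Real.log ((d : ℝ) * (k : ℝ)) ^ p ≤ (d' : ℝ) := by
  -- The exponent `0` of the logarithm suffices.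
  refine ⟨1 / 120, by norm_num, 0, fun d k d' hd hk ι h => ?_⟩
  have hmain : d * k ≤ 120 * d' := by
    rcases h with ⟨T, hT, hH⟩ | hH
    · exact Multiclass.le_of_essentiallyContains_tree hd hk ι T hT hH
    · exact Multiclass.le_of_essentiallyContains_ova hd hk ι hH
  have hreal : (d : ℝ) * k ≤ 120 * d' := by exact_mod_cast hmain
  rw [pow_zero, div_one]
  linarith
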